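/- A structured matrix $\bar A\in\{0,*\}^{n\times n}$ is a matrix each of whose entries is either a fixed zero or a free parameter $*$, the parameters being independent; let $n_{\bar A}$ be the number of its $*$ entries. A realization $A\in\mathbb R^{n\times n}$ of $\bar A$ is obtained by assigning real values to the $*$ entries, so realizations correspond to points of $\mathbb R^{n_{\bar A}}$. The generic rank $\operatorname{grank}\bar A$ is the maximum rank of a realization of $\bar A$. Call $\bar A$ generically diagonalizable if there is a proper algebraic variety $\mathbb V\subsetneq\mathbb R^{n_{\bar A}}$ (the set of real solutions of a system of polynomial equations, not the whole space) such that every realization $A\in\mathbb R^{n_{\bar A}}\setminus\mathbb V$ is diagonalizable over $\mathbb C$. Let $X=\{x_1,\dots,x_n\}$ and $E=\{(x_i,x_j):\bar A_{ji}\neq 0\}$. Let $\mathcal G(\bar A)=(X,E)$ be the associated digraph (self-loops allowed; a self-loop is a cycle, and a cycle repeats no vertex), and let $v(\bar A)$ be the maximum number of vertices covered by a collection of vertex-disjoint cycles in $\mathcal G(\bar A)$. Let $\mathcal B(\bar A)$ be the bipartite graph with left part a copy of $X$ (the rows), right part another copy of $X$ (the columns), and edge set $E$, an edge $(x_i,x_j)$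 joining the right vertex $x_i$ to the left vertex $x_j$. A matching is a set of edges no two of which share an end vertex in $\mathcal B(\bar A)$, and a maximum matching is one of largest size. Theorem. For every structured matrix $\bar A\in\{0,*\}^{n\times n}$ the following are equivalent: (a) $\bar A$ is generically diagonalizable. (b) $\operatorname{grank}\bar A=v(\bar A)$. (c) There is a maximum matching $\mathcal M$ of $\mathcal B(\bar A)$ such that the digraph $(X,\mathcal M)$ with vertex set $X$ and edge set $\mathcal M$ is a union of vertex-disjoint cycles and isolated vertices. -/

import Mathlib

/-- An entry of a structured matrix: a fixed zero, or a free parameter `*`. -/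
inductive StructEntry : Type
  | zero : StructEntry
  | star : StructEntry

/-- The set `{0,*}^{n₁ × n₂}` of structured matrices. -/
abbrev StructuredMatrix (n₁ n₂ : ℕ) : Type := Matrix (Fin n₁) (Fin n₂) StructEntry

namespace StructuredMatrix

variable {n₁ n₂ n : ℕ}

/-- The positions of the `*` entries; its cardinality is the number of free parameters. -/
abbrev FreeEntry (M : StructuredMatrix n₁ n₂) : Type :=
  {p : Fin n₁ × Fin n₂ // M p.1 p.2 = StructEntry.star}

/-- The parameter space: one real value for every `*` entry, chosen independently. -/
abbrev ParamSpace (M : StructuredMatrix n₁ n₂) : Type := FreeEntry M → ℝ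

open Classical in
/-- The realization of `M` for the parameter vector `θ`. -/
noncomputable def realization (M : StructuredMatrix n₁ n₂) (θ : ParamSpace M) :
    Matrix (Fin n₁) (Fin n₂) ℝ :=
  Matrix.of fun i j => if h : M i j = StructEntry.star then θ ⟨(i, j), h⟩ else 0

/-- The generic rank: the maximum rank over all realizations. -/
noncomputable def grank (M : StructuredMatrix n₁ n₂) : ℕ :=
  sSup (Set.range fun θ : ParamSpace M => (M.realization θ).rank)

/-- The supremum in the definition of the generic rank is a maximum. -/
theorem isGreatest_grank (M : StructuredMatrix n₁ n₂) :
    IsGreatest (Set.range fun θ : ParamSpace M => (M.realization θ).rank) (grank M) := by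
  have hne : (Set.range fun θ : ParamSpace M => (M.realization θ).rank).Nonempty :=
    ⟨_, ⟨fun _ => 0, rfl⟩⟩
  have hb : BddAbove (Set.range fun θ : ParamSpace M => (M.realization θ).rank) := by
    refine ⟨n₁, ?_⟩
    rintro _ ⟨θ, rfl⟩
    exact Matrix.rank_le_height _
  exact ⟨Nat.sSup_mem hne hb, fun _ hk => le_csSup hb hk⟩

end StructuredMatrix

/-- An algebraic variety in `ℝ^σ`: the real solution set of a system of polynomial equations. -/
def IsRealVariety {σ : Type} (V : Set (σ → ℝ)) : Prop :=
  ∃ S : Set (MvPolynomial σ ℝ), V = {θ | ∀ p ∈ S, MvPolynomial.eval θ p = 0}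

/-- A proper variety: an algebraic variety that is not the entire space. -/
def IsProperRealVariety {σ : Type} (V : Set (σ → ℝ)) : Prop :=
  IsRealVariety V ∧ V ≠ Set.univ

/-- A real square matrix is diagonalizable if it is similar, over the complex numbers, to a
diagonal matrix (its eigenvalues may be non-real). -/
def IsDiagonalizableOverComplex {n : ℕ} (A : Matrix (Fin n) (Fin n) ℝ) : Prop :=
  ∃ (P : Matrix (Fin n) (Fin n) ℂ) (d : Fin n → ℂ),
    IsUnit P ∧ A.map Complex.ofReal = P * Matrix.diagonal d * P⁻¹

/-- Almost all realizations, i.e. all outside some proper variety of the parameter space, are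
diagonalizable. -/
def StructuredMatrix.GenericallyDiagonalizable {n : ℕ} (A : StructuredMatrix n n) : Prop :=
  ∃ V : Set (A.ParamSpace), IsProperRealVariety V ∧
    ∀ θ : A.ParamSpace, θ ∉ V → IsDiagonalizableOverComplex (A.realization θ)

namespace Digraph

variable {V : Type} [DecidableEq V]

/-- A (simple, directed) cycle of a digraph: a nonempty cyclic sequence of distinct vertices, each
joined by an edge to the next one. A cyclic sequence of length one is a self-loop. -/
def IsDirectedCycle (G : Digraph V) (c : Cycle V) : Prop :=
  c ≠ Cycle.nil ∧ c.Nodup ∧ c.Chain G.Adj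

/-- A collection of vertex-disjoint cycles of a digraph. -/
def IsDisjointCycleCollection (G : Digraph V) (C : Set (Cycle V)) : Prop :=
  (∀ c ∈ C, G.IsDirectedCycle c) ∧
    ∀ c ∈ C, ∀ c' ∈ C, c ≠ c' → ∀ x, x ∈ c → x ∉ c'

/-- The vertices covered by a collection of cycles. -/
def coveredVertices (C : Set (Cycle V)) : Set V := {x | ∃ c ∈ C, x ∈ c}

/-- `(x, y)` is an edge of the cycle `c`: `y` follows `x` in `c`. -/
def IsCycleEdge (c : Cycle V) (x y : V) : Prop :=
  ∃ (hc : c.Nodup) (hx : x ∈ c), c.next hc x hx = y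

/-- The digraph is a union of vertex-disjoint cycles and isolated vertices: its edges are exactly
the edges of some vertex-disjoint cycles of it, and a vertex on none of these cycles is incident
to no edge. -/
def IsUnionOfDisjointCyclesAndIsolated (G : Digraph V) : Prop :=
  ∃ C : Set (Cycle V), G.IsDisjointCycleCollection C ∧
    (∀ x y, G.Adj x y ↔ ∃ c ∈ C, IsCycleEdge c x y) ∧
    ∀ x, x ∉ coveredVertices C → ∀ y, ¬ G.Adj x y ∧ ¬ G.Adj y x

end Digraph

/-- A bipartite graph with left part `L` and right part `R`; edges are directed from `R` to `L`.
A common label in `L` and `R` denotes two different vertices. -/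
structure BipartiteDigraph (L R : Type) where
  /-- The edge set. -/
  edges : Set (R × L)

namespace BipartiteDigraph

variable {L R : Type}

/-- A set of edges no two of which share an end vertex. -/
def IsMatching (B : BipartiteDigraph L R) (M : Finset (R × L)) : Prop :=
  (∀ e ∈ M, e ∈ B.edges) ∧
    ∀ e ∈ M, ∀ f ∈ M, e ≠ f → e.1 ≠ f.1 ∧ e.2 ≠ f.2

/-- A matching of the largest size among all matchings. -/
def IsMaximumMatching (B : BipartiteDigraph L R) (M : Finset (R × L)) : Prop :=
  B.IsMatching M ∧ ∀ M' : Finset (R × L), B.IsMatching M' → M'.card ≤ M.card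

end BipartiteDigraph

namespace StructuredMatrix

variable {n : ℕ}

/-- The digraph of a square structured matrix: an edge `x_i → x_j` when the `(j, i)` entry
is `*`. -/
def digraph (A : StructuredMatrix n n) : Digraph (Fin n) where
  Adj i j := A j i = StructEntry.star

/-- The bipartite graph of a structured matrix: the left part consists of the rows, the right part
of the columns, and column `i` is joined to row `j` when the `(j, i)` entry is `*`. -/
def bipartite {n₁ n₂ : ℕ} (M : StructuredMatrix n₁ n₂) : BipartiteDigraph (Fin n₁) (Fin n₂) where
  edges := {e | M e.2 e.1 = StructEntry.star}

/-- `v(A)`: the maximum number of vertices covered by a collection of vertex-disjoint cycles. -/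
noncomputable def maxCycleCover (A : StructuredMatrix n n) : ℕ :=
  sSup {k | ∃ C : Set (Cycle (Fin n)),
    A.digraph.IsDisjointCycleCollection C ∧ (Digraph.coveredVertices C).ncard = k}

/-- The supremum in the definition of `v(A)` is a maximum. -/
theorem isGreatest_maxCycleCover (A : StructuredMatrix n n) :
    IsGreatest {k | ∃ C : Set (Cycle (Fin n)),
      A.digraph.IsDisjointCycleCollection C ∧ (Digraph.coveredVertices C).ncard = k}
      (maxCycleCover A) := by
  have hne : {k | ∃ C : Set (Cycle (Fin n)),
      A.digraph.IsDisjointCycleCollection C ∧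
        (Digraph.coveredVertices C).ncard = k}.Nonempty :=
    ⟨_, ∅, ⟨fun _ h => h.elim, fun _ h => h.elim⟩, rfl⟩
  have hb : BddAbove {k | ∃ C : Set (Cycle (Fin n)),
      A.digraph.IsDisjointCycleCollection C ∧
        (Digraph.coveredVertices C).ncard = k} := by
    refine ⟨n, ?_⟩
    rintro _ ⟨C, -, rfl⟩
    simpa using Set.ncard_le_card (Digraph.coveredVertices C)
  exact ⟨Nat.sSup_mem hne hb, fun _ hk => le_csSup hb hk⟩

end StructuredMatrix

/-- The digraph `(X, ℳ)` with vertex set `X = Fin n` and edge set `ℳ`. -/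
def edgeSetDigraph {n : ℕ} (M : Finset (Fin n × Fin n)) : Digraph (Fin n) where
  Adj i j := (i, j) ∈ M

/-!
The coefficients of a characteristic polynomial are signed sums of principal minors, and a nonzero
principal minor on `s` contains a permutation of `s` along edges of the digraph, that is, disjoint
cycles covering `s`. Hence `X ^ (n - v)` divides the characteristic polynomial of every realization,
where `v` is the cycle-cover number. A diagonalizable matrix has rank `n` minus the multiplicity of
the eigenvalue `0`, so generic diagonalizability forces `grank ≤ v`. The reverse inequality always
holds: the edges of disjoint cycles form a matching, and the generic rank is the size of a maximum
matching, because nonzero minors contain matchings and the indicator of a matching is a partial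
permutation matrix. This also identifies the last two conditions.

Conversely, let `grank = v` and write the characteristic polynomial of the matrix of indeterminates
as `X ^ (n - v) * q`. The discriminant of `X * q` is not the zero polynomial: give the edges of a
maximal family of disjoint cycles weights that are constant on each cycle and differ between cycles,
and `0` to all other entries. The eigenvalues of a cycle of length `k` and weight `w` are `w * ζ`
with `ζ ^ k = 1`, which yields `v` distinct nonzero eigenvalues. Where the discriminant does not
vanish, there are `v` simple nonzero eigenvalues, and the rank bound makes the kernel of dimension
at least `n - v`, so the eigenvectors span.
-/

section Cycles

theorem rel_cycleNext_of_chain {α : Type*} [DecidableEq α] {r : α → α → Prop} {c : Cycle α}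
    (hr : c.Chain r) (hc : c.Nodup) {x : α} (hx : x ∈ c) : r x (c.next hc x hx) := by
  obtain ⟨l, rfl⟩ : ∃ l : List α, c = ↑(x :: l) := by
    induction c using Quot.inductionOn with
    | _ l =>
      obtain ⟨s, t, rfl⟩ := List.append_of_mem hx
      exact ⟨t ++ s, Cycle.coe_eq_coe.2 List.isRotated_append⟩
  rw [Cycle.chain_coe_cons] at hr
  cases l with
  | nil => exact hr.rel
  | cons y l =>
    change r x (List.next (x :: y :: l) x List.mem_cons_self)
    rw [List.next_cons_cons_eq]
    exact hr.rel

variable {V : Type} {G : Digraph V}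

/-- The permutation `σ` maps `S` to itself along edges of `G`. On a finite vertex set this encodes
a collection of vertex-disjoint cycles of `G` covering exactly `S`, the restrictions to `S` of the
cycles of `σ`; outside `S` the permutation is arbitrary. -/
def IsPermutationCover (G : Digraph V) (σ : Equiv.Perm V) (S : Set V) : Prop :=
  ∀ x ∈ S, σ x ∈ S ∧ G.Adj x (σ x)

theorem IsPermutationCover.iterate_mem {σ : Equiv.Perm V} {S : Set V}
    (h : IsPermutationCover G σ S) {x : V} (hx : x ∈ S) (k : ℕ) : σ^[k] x ∈ S :=
  (show Set.MapsTo σ S S from fun y hy => (h y hy).1).iterate k hx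

theorem exists_isPermutationCover_coveredVertices [Finite V] {C : Set (Cycle V)}
    (hC : G.IsDisjointCycleCollection C) :
    ∃ σ, IsPermutationCover G σ (Digraph.coveredVertices C) := by
  classical
  choose c hc hxc using fun x : Digraph.coveredVertices C => x.2
  have eq_of_mem {d : Cycle V} (hd : d ∈ C) (x : Digraph.coveredVertices C) (hx : x.1 ∈ d) :
      c x = d := by
    by_contra hne
    exact hC.2 _ (hc x) _ hd hne _ (hxc x) hx
  have nodup (x) : (c x).Nodup := (hC.1 _ (hc x)).2.1
  let next (x : Digraph.coveredVertices C) : Digraph.coveredVertices C :=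
    ⟨(c x).next (nodup x) x (hxc x), c x, hc x, Cycle.next_mem _ _ _ _⟩
  have next_injective : Function.Injective next := by
    intro x y hxy
    have hval : (c x).next (nodup x) x (hxc x) = (c y).next (nodup y) y (hxc y) :=
      congrArg Subtype.val hxy
    have hcyc : c x = c y := by
      rw [← eq_of_mem (hc x) (next x) (Cycle.next_mem _ _ _ _), hxy]
      exact eq_of_mem (hc y) (next y) (Cycle.next_mem _ _ _ _)
    apply Subtype.ext
    rw [← Cycle.prev_next (c x) (nodup x) x (hxc x), ← Cycle.prev_next (c y) (nodup y) y (hxc y)]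
    simp only [hcyc] at hval ⊢
    simp only [hval]
  let σ := Equiv.ofBijective next (Finite.injective_iff_bijective.1 next_injective)
  refine ⟨Equiv.Perm.ofSubtype σ, fun x hx => ?_⟩
  rw [Equiv.Perm.ofSubtype_apply_of_mem σ hx]
  exact ⟨(σ ⟨x, hx⟩).2,
    rel_cycleNext_of_chain (hC.1 _ (hc ⟨x, hx⟩)).2.2 (nodup _) (hxc ⟨x, hx⟩)⟩

theorem IsPermutationCover.exists_isDisjointCycleCollection [Finite V] {σ : Equiv.Perm V}
    {S : Set V} (h : IsPermutationCover G σ S) :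
    ∃ C, G.IsDisjointCycleCollection C ∧ Digraph.coveredVertices C = S := by
  have periodic (x : V) : x ∈ Function.periodicPts σ := σ.injective.mem_periodicPts x
  refine ⟨Function.periodicOrbit σ '' S, ⟨?_, ?_⟩, ?_⟩
  · rintro _ ⟨x, hx, rfl⟩
    refine ⟨by simp [periodic x], Function.nodup_periodicOrbit, ?_⟩
    rw [Function.periodicOrbit_chain' _ (periodic x)]
    intro k
    rw [Function.iterate_succ_apply']
    exact (h _ (h.iterate_mem hx k)).2
  · rintro _ ⟨x, -, rfl⟩ _ ⟨y, -, rfl⟩ hne z hzx hzy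
    obtain ⟨i, rfl⟩ := (Function.mem_periodicOrbit_iff (periodic x)).1 hzx
    obtain ⟨j, hj⟩ := (Function.mem_periodicOrbit_iff (periodic y)).1 hzy
    apply hne
    rw [← Function.periodicOrbit_apply_iterate_eq (periodic x) i, ← hj,
      Function.periodicOrbit_apply_iterate_eq (periodic y) j]
  · ext z
    constructor
    · rintro ⟨_, ⟨x, hx, rfl⟩, hz⟩
      obtain ⟨i, rfl⟩ := (Function.mem_periodicOrbit_iff (periodic x)).1 hz
      exact h.iterate_mem hx i
    · exact fun hz => ⟨_, ⟨z, hz, rfl⟩, Function.self_mem_periodicOrbit (periodic z)⟩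

theorem isUnionOfDisjointCyclesAndIsolated_of_adj_iff [DecidableEq V] [Finite V]
    {σ : Equiv.Perm V} {S : Set V} (hS : Set.MapsTo σ S S)
    (hG : ∀ x y, G.Adj x y ↔ x ∈ S ∧ σ x = y) :
    G.IsUnionOfDisjointCyclesAndIsolated := by
  have cover : IsPermutationCover G σ S := fun x hx => ⟨hS hx, (hG x _).2 ⟨hx, rfl⟩⟩
  obtain ⟨C, hC, rfl⟩ := cover.exists_isDisjointCycleCollection
  have adj_next {c : Cycle V} (hc : c ∈ C) {x : V} (hx : x ∈ c) :
      G.Adj x (c.next (hC.1 c hc).2.1 x hx) :=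
    rel_cycleNext_of_chain (hC.1 c hc).2.2 _ hx
  refine ⟨C, hC, fun x y => ⟨fun hxy => ?_, ?_⟩, fun x hx y => ⟨fun hxy => ?_, fun hyx => ?_⟩⟩
  · obtain ⟨⟨c, hc, hx⟩, rfl⟩ := (hG x y).1 hxy
    exact ⟨c, hc, (hC.1 c hc).2.1, hx, ((hG x _).1 (adj_next hc hx)).2.symm⟩
  · rintro ⟨c, hc, _, hx, rfl⟩
    exact adj_next hc hx
  · exact hx ((hG x y).1 hxy).1
  · obtain ⟨hy, rfl⟩ := (hG y x).1 hyx
    exact hx (hS hy)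

end Cycles

section Rank

variable {K m n : Type*} [Field K] [Fintype n]

theorem exists_linearIndependent_submatrix_rows [Finite m] (A : Matrix m n K) {r : ℕ}
    (hr : A.rank = r) :
    ∃ e : Fin r → m, Function.Injective e ∧ LinearIndependent K (A.submatrix e id).row := by
  rw [Matrix.rank_eq_finrank_span_row] at hr
  subst hr
  obtain ⟨f, hf, -, hli⟩ :=
    Submodule.exists_fun_fin_finrank_span_eq K (Set.range A.row)
  choose e he using hf
  rw [← (funext he : (A.submatrix e id).row = f)] at hli
  exact ⟨e, Function.Injective.of_comp (f := A.row) hli.injective, hli⟩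

theorem exists_submatrix_rank_det_ne_zero [Finite m] (A : Matrix m n K) :
    ∃ (e : Fin A.rank → m) (f : Fin A.rank → n),
      Function.Injective e ∧ Function.Injective f ∧ (A.submatrix e f).det ≠ 0 := by
  obtain ⟨e, he, he_indep⟩ := exists_linearIndependent_submatrix_rows A rfl
  have hrank : (A.submatrix e id).transpose.rank = A.rank := by
    rw [Matrix.rank_transpose, he_indep.rank_matrix, Fintype.card_fin]
  obtain ⟨f, hf, hf_indep⟩ := exists_linearIndependent_submatrix_rows _ hrank
  refine ⟨e, f, he, hf, ?_⟩
  rw [← Matrix.det_transpose]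
  exact ((Matrix.isUnit_iff_isUnit_det _).1
    (Matrix.linearIndependent_rows_iff_isUnit.1 hf_indep)).ne_zero

theorem card_le_rank_of_submatrix_det_ne_zero {κ : Type*} [Fintype κ] [DecidableEq κ] [Finite m]
    {A : Matrix m n K} {e : κ → m} {f : κ → n} (h : (A.submatrix e f).det ≠ 0) :
    Fintype.card κ ≤ A.rank := by
  rw [← Matrix.rank_of_det_ne_zero h]
  exact Matrix.rank_submatrix_le A e f

end Rank

section Diagonalization

variable {ι K : Type*} [Fintype ι] [DecidableEq ι] [Field K]

/-- The square matrix `B` is diagonalizable over its own field of entries: it is similar to a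
diagonal matrix. -/
def IsDiagonalizable (B : Matrix ι ι K) : Prop :=
  ∃ (P : Matrix ι ι K) (d : ι → K), IsUnit P ∧ B = P * Matrix.diagonal d * P⁻¹

theorem isDiagonalizable_of_eigenvectors {B : Matrix ι ι K} {v : ι → ι → K}
    (hv : LinearIndependent K v) {d : ι → K} (h : ∀ i, B.mulVec (v i) = d i • v i) :
    IsDiagonalizable B := by
  have hP : IsUnit (Matrix.of v).transpose := Matrix.linearIndependent_cols_iff_isUnit.1 hv
  refine ⟨(Matrix.of v).transpose, d, hP, ?_⟩
  let _ := hP.invertible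
  rw [eq_comm, Matrix.mul_inv_eq_iff_eq_mul_of_invertible]
  ext i j
  rw [Matrix.mul_diagonal]
  simpa [Matrix.mul_apply, Matrix.mulVec, dotProduct, mul_comm] using
    (congrFun (h j) i).symm

theorem IsDiagonalizable.rank_add_rootMultiplicity_charpoly {B : Matrix ι ι K}
    (hB : IsDiagonalizable B) :
    B.rank + B.charpoly.rootMultiplicity 0 = Fintype.card ι := by
  classical
  obtain ⟨_, d, ⟨P, rfl⟩, rfl⟩ := hB
  have hdet : IsUnit (P : Matrix ι ι K).det := (Matrix.isUnit_iff_isUnit_det _).1 P.isUnit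
  have rank_eq : ((P : Matrix ι ι K) * Matrix.diagonal d * (P : Matrix ι ι K)⁻¹).rank =
      Fintype.card {i // d i ≠ 0} := by
    rw [Matrix.rank_mul_eq_left_of_isUnit_det _ _ (Matrix.isUnit_nonsing_inv_det _ hdet),
      Matrix.rank_mul_eq_right_of_isUnit_det _ _ hdet, Matrix.rank_diagonal]
  have roots_eq : (∏ i, (Polynomial.X - Polynomial.C (d i))).roots = Finset.univ.val.map d := by
    rw [← Polynomial.roots_multiset_prod_X_sub_C (Finset.univ.val.map d), Multiset.map_map]
    rfl
  have mult_eq : (∏ i, (Polynomial.X - Polynomial.C (d i))).rootMultiplicity 0 =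
      Fintype.card {i // d i = 0} := by
    rw [← Polynomial.count_roots, roots_eq, Multiset.count_map, Fintype.card_subtype]
    simp only [eq_comm (a := (0 : K))]
    rfl
  rw [rank_eq, Matrix.charpoly_units_conj, Matrix.charpoly_diagonal, mult_eq, add_comm,
    Fintype.card_subtype_compl, Nat.add_sub_of_le (Fintype.card_subtype_le _)]

theorem isDiagonalizable_of_hasEigenvalue {κ : Type*} [Fintype κ] {B : Matrix ι ι K} {μ : κ → K}
    (hμ : ∀ k, Module.End.HasEigenvalue (Matrix.toLin' B) (μ k)) (hinj : Function.Injective μ)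
    (hne : ∀ k, μ k ≠ 0) (hrank : B.rank ≤ Fintype.card κ) :
    IsDiagonalizable B := by
  set T := Matrix.toLin' B
  choose v hv using fun k => (hμ k).exists_hasEigenvector
  have hv_indep : LinearIndependent K v := Module.End.eigenvectors_linearIndependent' T μ hinj v hv
  let w := Module.finBasis K (LinearMap.ker T)
  have hw_indep : LinearIndependent K fun i => (w i : ι → K) :=
    w.linearIndependent.map' (Submodule.subtype _) (Submodule.ker_subtype _)
  have hdisjoint : Disjoint (Submodule.span K (Set.range v))
      (Submodule.span K (Set.range fun i => (w i : ι → K))) := by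
    refine (Module.End.eigenspaces_iSupIndep T 0).symm.mono ?_ ?_ <;>
      rw [Submodule.span_le, Set.range_subset_iff]
    · exact fun k => Submodule.mem_iSup_of_mem (μ k) (Submodule.mem_iSup_of_mem (hne k) (hv k).1)
    · exact fun i => (Module.End.eigenspace_zero T).ge (w i).2
  have hindep := hv_indep.sum_type hw_indep hdisjoint
  have hcard : Fintype.card ι = Fintype.card (κ ⊕ Fin (Module.finrank K (LinearMap.ker T))) := by
    have hle := hindep.fintype_card_le_finrank
    have hnull := T.finrank_range_add_finrank_ker
    rw [Module.finrank_fintype_fun_eq_card] at hle hnull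
    simp only [Fintype.card_sum, Fintype.card_fin] at hle ⊢
    change B.rank + _ = _ at hnull
    omega
  let e := Fintype.equivOfCardEq hcard
  refine isDiagonalizable_of_eigenvectors (hindep.comp e e.injective)
    (d := Sum.elim μ 0 ∘ e) fun i => ?_
  dsimp only [Function.comp_apply]
  rcases e i with k | j
  · exact (hv k).apply_eq_smul
  · simp only [Sum.elim_inr, Pi.zero_apply, zero_smul]
    exact LinearMap.mem_ker.1 (w j).2

open Polynomial in
theorem isDiagonalizable_of_charpoly_eq_X_pow_mul [IsAlgClosed K] {B : Matrix ι ι K} {m : ℕ}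
    {q : K[X]} (hchar : B.charpoly = X ^ m * q) (hsep : (X * q).Separable)
    (hrank : B.rank + m ≤ Fintype.card ι) :
    IsDiagonalizable B := by
  classical
  have hq : q.Separable := hsep.of_mul_right
  have hdegree : m + q.natDegree = Fintype.card ι := by
    rw [← B.charpoly_natDegree_eq_dim, hchar, natDegree_X_pow_mul _ hq.ne_zero, add_comm]
  have hroot (a : q.roots.toFinset) : q.IsRoot a :=
    isRoot_of_mem_roots (Multiset.mem_toFinset.1 a.2)
  refine isDiagonalizable_of_hasEigenvalue (μ := fun a : q.roots.toFinset => (a : K))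
    (fun a => ?_) Subtype.val_injective (fun a ha => ?_) ?_
  · rw [Module.End.hasEigenvalue_iff_isRoot_charpoly, Matrix.charpoly_toLin', hchar]
    exact root_mul_left_of_isRoot _ (hroot a)
  · have hzero := hroot a
    rw [ha] at hzero
    obtain ⟨u, v, huv⟩ := hsep.isCoprime
    simpa [hzero.eq_zero] using congrArg (eval 0) huv
  · rw [Fintype.card_coe, Multiset.toFinset_card_of_nodup (nodup_roots hq),
      splits_iff_card_roots.1 (IsAlgClosed.splits q)]
    omega

end Diagonalization

section Separable

open Polynomial

theorem separable_of_natDegree_le_card_roots {K κ : Type*} [Field K] [Fintype κ] {f : K[X]}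
    (hf : f ≠ 0) {μ : κ → K} (hinj : Function.Injective μ) (hroot : ∀ k, f.IsRoot (μ k))
    (hdegree : f.natDegree ≤ Fintype.card κ) : f.Separable := by
  classical
  have hcard : Fintype.card κ ≤ f.roots.toFinset.card := by
    rw [← Finset.card_univ, ← Finset.card_image_of_injective _ hinj]
    refine Finset.card_le_card (Finset.image_subset_iff.2 fun k _ => ?_)
    exact Multiset.mem_toFinset.2 ((mem_roots hf).2 (hroot k))
  have htoFinset := Multiset.toFinset_card_le f.roots
  have hroots := card_roots' f
  have hsplits : f.Splits := splits_iff_card_roots.2 (by omega)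
  rw [← nodup_roots_iff_of_splits hf hsplits, ← Multiset.toFinset_card_eq_card_iff_nodup]
  omega

theorem separable_X_mul_of_charpoly_eq {K ι κ : Type*} [Field K] [Fintype ι] [DecidableEq ι]
    [Fintype κ] {B : Matrix ι ι K} {m : ℕ} {q : K[X]} (hchar : B.charpoly = X ^ m * q) {μ : κ → K}
    (hμ : ∀ k, Module.End.HasEigenvalue (Matrix.toLin' B) (μ k)) (hinj : Function.Injective μ)
    (hne : ∀ k, μ k ≠ 0) (hcard : Fintype.card ι ≤ m + Fintype.card κ) : (X * q).Separable := by
  have hq : q ≠ 0 := right_ne_zero_of_mul (hchar ▸ B.charpoly_monic.ne_zero)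
  have hroot (k : κ) : q.IsRoot (μ k) := by
    have h : (X ^ m * q).IsRoot (μ k) := by
      rw [← hchar, ← Matrix.charpoly_toLin']
      exact (Module.End.hasEigenvalue_iff_isRoot_charpoly _ _).1 (hμ k)
    simpa [hne k] using h
  have hdegree : q.natDegree + m = Fintype.card ι := by
    rw [← B.charpoly_natDegree_eq_dim, hchar, natDegree_X_pow_mul _ hq]
  refine separable_of_natDegree_le_card_roots (mul_ne_zero X_ne_zero hq)
    (μ := fun k : Option κ => k.elim 0 μ) ?_ ?_ ?_
  · exact Option.injective_iff.2 ⟨hinj, by simpa using hne⟩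
  · rintro (_ | k)
    · simp
    · simp [(hroot k).eq_zero]
  · rw [natDegree_X_mul hq, Fintype.card_option]
    omega

theorem map_resultant_derivative_ne_zero_iff {R K : Type*} [CommRing R] [Field K] (φ : R →+* K)
    {f : R[X]} (hf : f.Monic) :
    φ (resultant f (derivative f) f.natDegree f.natDegree) ≠ 0 ↔ (f.map φ).Separable := by
  have hmonic := hf.map φ
  have resultant_padded : resultant (f.map φ) (derivative (f.map φ)) (f.map φ).natDegree
      (f.map φ).natDegree = resultant (f.map φ) (derivative (f.map φ)) := by
    obtain ⟨k, hk⟩ := Nat.exists_eq_add_of_le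
      ((natDegree_derivative_le (f.map φ)).trans (Nat.sub_le _ _))
    have h := resultant_add_right_deg (f.map φ) _ (f.map φ).natDegree _ k
      (le_refl (derivative (f.map φ)).natDegree)
    rwa [← hk, coeff_natDegree, hmonic.leadingCoeff, one_pow, one_mul] at h
  rw [← resultant_map_map, ← derivative_map, ← hf.natDegree_map φ, resultant_padded,
    ← isUnit_iff_ne_zero, isUnit_resultant_iff_isCoprime hmonic, separable_def]

end Separable

section Generic

open MvPolynomial

variable {σ R : Type*} [CommRing R] {Q Q' : (σ → R) → Prop}

/-- `Q` holds at every point where some fixed nonzero polynomial does not vanish. Over an infinite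
domain this says that `Q` holds outside a proper algebraic variety. -/
def HoldsGenerically (Q : (σ → R) → Prop) : Prop :=
  ∃ p : MvPolynomial σ R, p ≠ 0 ∧ ∀ θ, eval θ p ≠ 0 → Q θ

theorem HoldsGenerically.and [NoZeroDivisors R] (h : HoldsGenerically Q)
    (h' : HoldsGenerically Q') :
    HoldsGenerically fun θ => Q θ ∧ Q' θ := by
  obtain ⟨p, hp, hQ⟩ := h
  obtain ⟨p', hp', hQ'⟩ := h'
  refine ⟨p * p', mul_ne_zero hp hp', fun θ hθ => ?_⟩
  rw [map_mul] at hθ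
  exact ⟨hQ θ (left_ne_zero_of_mul hθ), hQ' θ (right_ne_zero_of_mul hθ)⟩

theorem HoldsGenerically.exists [IsDomain R] [Infinite R] (h : HoldsGenerically Q) : ∃ θ, Q θ := by
  obtain ⟨p, hp, hQ⟩ := h
  obtain ⟨θ, hθ⟩ : ∃ θ, eval θ p ≠ 0 := by
    by_contra! hvanish
    exact hp (funext fun θ => by rw [hvanish θ, map_zero])
  exact ⟨θ, hQ θ hθ⟩

theorem holdsGenerically_iff_exists_isProperRealVariety {σ : Type} {Q : (σ → ℝ) → Prop} :
    HoldsGenerically Q ↔ ∃ V, IsProperRealVariety V ∧ ∀ θ ∉ V, Q θ := by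
  constructor
  · rintro ⟨p, hp, hQ⟩
    refine ⟨{θ | eval θ p = 0}, ⟨⟨{p}, by simp⟩, fun hV => hp (funext fun θ => ?_)⟩, hQ⟩
    rw [map_zero]
    exact Set.eq_univ_iff_forall.1 hV θ
  · rintro ⟨_, ⟨⟨S, rfl⟩, hV⟩, hQ⟩
    obtain ⟨θ₀, hθ₀⟩ := (Set.ne_univ_iff_exists_notMem _).1 hV
    simp only [Set.mem_ofPred_eq, not_forall] at hθ₀
    obtain ⟨p, hpS, hp⟩ := hθ₀
    refine ⟨p, fun h => hp (by rw [h, map_zero]), fun θ hθ => hQ θ fun hθV => hθ (hθV p hpS)⟩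

end Generic

theorem exists_perm_apply_ne_zero_of_det_ne_zero {ι R : Type*} [Fintype ι] [DecidableEq ι]
    [CommRing R] {B : Matrix ι ι R} (hB : B.det ≠ 0) :
    ∃ σ : Equiv.Perm ι, ∀ i, B (σ i) i ≠ 0 := by
  rw [Matrix.det_apply] at hB
  obtain ⟨σ, -, hσ⟩ := Finset.exists_ne_zero_of_sum_ne_zero hB
  refine ⟨σ, fun i hi => right_ne_zero_of_smul hσ ?_⟩
  exact Finset.prod_eq_zero (Finset.mem_univ i) hi

namespace StructuredMatrix

section Support

variable {n₁ n₂ : ℕ} {A : StructuredMatrix n₁ n₂}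

/-- The matrix `B`, over an arbitrary ring, vanishes at the fixed zeros of `A`. This covers the real
realizations, their complexifications, and the realization by indeterminates. -/
def Supports {R : Type*} [Zero R] (A : StructuredMatrix n₁ n₂) (B : Matrix (Fin n₁) (Fin n₂) R) :
    Prop :=
  ∀ i j, B i j ≠ 0 → A i j = StructEntry.star

theorem supports_realization (θ : A.ParamSpace) : A.Supports (A.realization θ) := by
  intro i j
  contrapose!
  simp +contextual [realization]

theorem Supports.map {R S : Type*} [NonAssocSemiring R] [NonAssocSemiring S]
    {B : Matrix (Fin n₁) (Fin n₂) R} (hB : A.Supports B) (φ : R →+* S) : A.Supports (B.map φ) :=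
  fun i j hij => hB i j fun h => hij (by rw [Matrix.map_apply, h, map_zero])

theorem Supports.exists_isMatching_card_eq_rank {K : Type*} [Field K]
    {B : Matrix (Fin n₁) (Fin n₂) K} (hB : A.Supports B) :
    ∃ M, A.bipartite.IsMatching M ∧ M.card = B.rank := by
  obtain ⟨e, f, he, hf, hdet⟩ := exists_submatrix_rank_det_ne_zero B
  obtain ⟨σ, hσ⟩ := exists_perm_apply_ne_zero_of_det_ne_zero hdet
  refine ⟨Finset.univ.image fun i => (f i, e (σ i)), ⟨?_, ?_⟩, ?_⟩
  · simp only [Finset.mem_image]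
    rintro _ ⟨i, -, rfl⟩
    exact hB _ _ (hσ i)
  · simp only [Finset.mem_image]
    rintro _ ⟨i, -, rfl⟩ _ ⟨j, -, rfl⟩ hne
    have hij : i ≠ j := fun h => hne (by rw [h])
    exact ⟨hf.ne hij, he.ne (σ.injective.ne hij)⟩
  · rw [Finset.card_image_of_injective _ fun i j h => hf (congrArg Prod.fst h), Finset.card_univ,
      Fintype.card_fin]

theorem rank_realization_le_grank (θ : A.ParamSpace) : (A.realization θ).rank ≤ A.grank :=
  A.isGreatest_grank.2 ⟨θ, rfl⟩

theorem card_le_grank_of_isMatching {M : Finset (Fin n₂ × Fin n₁)}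
    (hM : A.bipartite.IsMatching M) : M.card ≤ A.grank := by
  classical
  let θ : A.ParamSpace := fun p => if (p.1.2, p.1.1) ∈ M then 1 else 0
  have indicator (i j) : A.realization θ i j = if (j, i) ∈ M then 1 else 0 := by
    by_cases h : A i j = StructEntry.star
    · simp [realization, h, θ]
    · have : (j, i) ∉ M := fun hmem => h (hM.1 _ hmem)
      simp [realization, h, this]
  have mem_iff (e f : M) : (f.1.1, e.1.2) ∈ M ↔ e = f := by
    refine ⟨fun hmem => ?_, fun h => h ▸ e.2⟩
    have heq : (f.1.1, e.1.2) = e.1 := by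
      by_contra hne
      exact (hM.2 _ hmem _ e.2 hne).2 rfl
    by_contra hef
    exact (hM.2 _ e.2 _ f.2 (Subtype.coe_ne_coe.2 hef)).1 (congrArg Prod.fst heq).symm
  have submatrix_eq :
      (A.realization θ).submatrix (fun e : M => e.1.2) (fun e : M => e.1.1) = 1 := by
    ext e f
    rw [Matrix.submatrix_apply, indicator, Matrix.one_apply]
    simp only [mem_iff]
  calc M.card = Fintype.card M := (Fintype.card_coe M).symm
    _ ≤ (A.realization θ).rank :=
      card_le_rank_of_submatrix_det_ne_zero
        (by rw [submatrix_eq, Matrix.det_one]; exact one_ne_zero)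
    _ ≤ A.grank := rank_realization_le_grank θ

theorem Supports.rank_le_grank {K : Type*} [Field K] {B : Matrix (Fin n₁) (Fin n₂) K}
    (hB : A.Supports B) : B.rank ≤ A.grank := by
  obtain ⟨M, hM, hcard⟩ := hB.exists_isMatching_card_eq_rank
  exact hcard ▸ card_le_grank_of_isMatching hM

theorem card_eq_grank_of_isMaximumMatching {M : Finset (Fin n₂ × Fin n₁)}
    (hM : A.bipartite.IsMaximumMatching M) : M.card = A.grank := by
  obtain ⟨θ, hθ⟩ := A.isGreatest_grank.1
  obtain ⟨M', hM', hcard⟩ := (supports_realization θ).exists_isMatching_card_eq_rank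
  refine (card_le_grank_of_isMatching hM.1).antisymm ?_
  calc A.grank = M'.card := hθ.symm.trans hcard.symm
    _ ≤ M.card := hM.2 M' hM'

end Support

section CycleCover

variable {n : ℕ} {A : StructuredMatrix n n}

theorem ncard_le_maxCycleCover {σ : Equiv.Perm (Fin n)} {S : Set (Fin n)}
    (h : IsPermutationCover A.digraph σ S) : S.ncard ≤ A.maxCycleCover := by
  obtain ⟨C, hC, rfl⟩ := h.exists_isDisjointCycleCollection
  exact A.isGreatest_maxCycleCover.2 ⟨C, hC, rfl⟩

theorem maxCycleCover_le (A : StructuredMatrix n n) : A.maxCycleCover ≤ n := by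
  obtain ⟨C, -, hcard⟩ := A.isGreatest_maxCycleCover.1
  rw [← hcard]
  simpa using Set.ncard_le_card (Digraph.coveredVertices C)

theorem exists_isPermutationCover_ncard_eq_maxCycleCover (A : StructuredMatrix n n) :
    ∃ σ S, IsPermutationCover A.digraph σ S ∧ S.ncard = A.maxCycleCover := by
  obtain ⟨C, hC, hcard⟩ := A.isGreatest_maxCycleCover.1
  obtain ⟨σ, hσ⟩ := exists_isPermutationCover_coveredVertices hC
  exact ⟨σ, _, hσ, hcard⟩

theorem exists_isMatching_of_isPermutationCover {σ : Equiv.Perm (Fin n)} {S : Set (Fin n)}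
    (h : IsPermutationCover A.digraph σ S) :
    ∃ M, A.bipartite.IsMatching M ∧ M.card = S.ncard ∧
      (edgeSetDigraph M).IsUnionOfDisjointCyclesAndIsolated := by
  classical
  refine ⟨S.toFinset.image fun x => (x, σ x), ⟨?_, ?_⟩, ?_, ?_⟩
  · simp only [Finset.mem_image, Set.mem_toFinset]
    rintro _ ⟨x, hx, rfl⟩
    exact (h x hx).2
  · simp only [Finset.mem_image]
    rintro _ ⟨x, -, rfl⟩ _ ⟨y, -, rfl⟩ hne
    have hxy : x ≠ y := fun hxy => hne (by rw [hxy])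
    exact ⟨hxy, σ.injective.ne hxy⟩
  · rw [Finset.card_image_of_injective _ fun x y hxy => congrArg Prod.fst hxy,
      Set.ncard_eq_toFinset_card']
  · refine isUnionOfDisjointCyclesAndIsolated_of_adj_iff (fun x hx => (h x hx).1) fun x y => ?_
    simp [edgeSetDigraph]

theorem maxCycleCover_le_grank (A : StructuredMatrix n n) : A.maxCycleCover ≤ A.grank := by
  obtain ⟨σ, S, hσ, hcard⟩ := A.exists_isPermutationCover_ncard_eq_maxCycleCover
  obtain ⟨M, hM, hMcard, -⟩ := exists_isMatching_of_isPermutationCover hσ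
  rw [← hcard, ← hMcard]
  exact card_le_grank_of_isMatching hM

theorem exists_isMaximumMatching_isUnionOfDisjointCyclesAndIsolated
    (h : A.grank = A.maxCycleCover) :
    ∃ M, A.bipartite.IsMaximumMatching M ∧
      (edgeSetDigraph M).IsUnionOfDisjointCyclesAndIsolated := by
  obtain ⟨σ, S, hσ, hcard⟩ := A.exists_isPermutationCover_ncard_eq_maxCycleCover
  obtain ⟨M, hM, hMcard, hunion⟩ := exists_isMatching_of_isPermutationCover hσ
  refine ⟨M, ⟨hM, fun M' hM' => ?_⟩, hunion⟩
  rw [hMcard, hcard, ← h]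
  exact card_le_grank_of_isMatching hM'

theorem card_le_maxCycleCover_of_isUnionOfDisjointCyclesAndIsolated
    {M : Finset (Fin n × Fin n)} (hM : A.bipartite.IsMatching M)
    (hunion : (edgeSetDigraph M).IsUnionOfDisjointCyclesAndIsolated) :
    M.card ≤ A.maxCycleCover := by
  obtain ⟨C, ⟨hcycle, hdisjoint⟩, -, hisolated⟩ := hunion
  have hC : A.digraph.IsDisjointCycleCollection C :=
    ⟨fun c hc => ⟨(hcycle c hc).1, (hcycle c hc).2.1,
      (hcycle c hc).2.2.imp fun x y hxy => hM.1 (x, y) hxy⟩, hdisjoint⟩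
  have fst_injOn : Set.InjOn Prod.fst (M : Set (Fin n × Fin n)) := by
    intro e he f hf hef
    by_contra hne
    exact (hM.2 e he f hf hne).1 hef
  have fst_covered : Prod.fst '' (M : Set (Fin n × Fin n)) ⊆ Digraph.coveredVertices C := by
    rintro _ ⟨e, he, rfl⟩
    by_contra hcov
    exact (hisolated e.1 hcov e.2).1 he
  calc M.card = (Prod.fst '' (M : Set (Fin n × Fin n))).ncard := by
        rw [fst_injOn.ncard_image, Set.ncard_coe_finset]
    _ ≤ (Digraph.coveredVertices C).ncard := Set.ncard_le_ncard fst_covered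
    _ ≤ A.maxCycleCover := A.isGreatest_maxCycleCover.2 ⟨C, hC, rfl⟩

theorem Supports.det_principal_submatrix_eq_zero {R : Type*} [CommRing R]
    {B : Matrix (Fin n) (Fin n) R} (hB : A.Supports B) {s : Finset (Fin n)}
    (hs : A.maxCycleCover < s.card) :
    (B.submatrix (Subtype.val : s → Fin n) Subtype.val).det = 0 := by
  by_contra hdet
  obtain ⟨σ, hσ⟩ := exists_perm_apply_ne_zero_of_det_ne_zero hdet
  have hcover : IsPermutationCover A.digraph (Equiv.Perm.ofSubtype σ) s := by
    intro x hx
    rw [Equiv.Perm.ofSubtype_apply_of_mem σ hx]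
    exact ⟨(σ ⟨x, hx⟩).2, hB _ _ (hσ ⟨x, hx⟩)⟩
  have hle := ncard_le_maxCycleCover hcover
  rw [Set.ncard_coe_finset] at hle
  omega

open Polynomial in
theorem Supports.X_pow_dvd_charpoly {R : Type*} [CommRing R]
    {B : Matrix (Fin n) (Fin n) R} (hB : A.Supports B) :
    X ^ (n - A.maxCycleCover) ∣ B.charpoly := by
  rw [X_pow_dvd_iff]
  intro d hd
  have hcoeff := Matrix.charpoly_coeff_eq_sum_minors B (n - d) (by simp)
  rw [Fintype.card_fin, Nat.sub_sub_self (by omega)] at hcoeff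
  rw [hcoeff, Finset.sum_eq_zero, mul_zero]
  intro s hs
  have hcard : s.card = n - d := (Finset.mem_powersetCard.1 hs).2
  exact hB.det_principal_submatrix_eq_zero (by omega)

end CycleCover

end StructuredMatrix

section WeightedPermutation

variable {ι : Type*}

theorem hasEigenvalue_of_mulVec_single_iterate {K : Type*} [Field K] [Fintype ι] [DecidableEq ι]
    {B : Matrix ι ι K} {σ : Equiv.Perm ι} {x : ι} {w ζ : K}
    (hB : ∀ j, B.mulVec (Pi.single (σ^[j] x) 1) = w • Pi.single (σ^[j + 1] x) 1)
    (hζ : ζ ^ Function.minimalPeriod σ x = 1) :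
    Module.End.HasEigenvalue (Matrix.toLin' B) (w * ζ) := by
  set k := Function.minimalPeriod σ x
  have hk : 0 < k := Function.minimalPeriod_pos_of_mem_periodicPts (σ.injective.mem_periodicPts x)
  have hζ_ne : ζ ≠ 0 := by
    rintro rfl
    exact zero_ne_one ((zero_pow hk.ne').symm.trans hζ)
  -- The eigenvector is the discrete Fourier sum of the basis vectors along the cycle of `x`.
  let term (j : ℕ) : ι → K := ζ⁻¹ ^ j • Pi.single (σ^[j] x) 1
  have term_k : term k = term 0 := by
    simp only [term, k, Function.iterate_minimalPeriod, inv_pow, hζ, pow_zero, inv_one,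
      Function.iterate_zero, id]
  have shift : ∑ j ∈ Finset.range k, term (j + 1) = ∑ j ∈ Finset.range k, term j := by
    have h := Finset.sum_range_succ term k
    rw [Finset.sum_range_succ', term_k] at h
    exact add_right_cancel h
  have mulVec_term (j : ℕ) : B.mulVec (term j) = (w * ζ) • term (j + 1) := by
    simp only [term, Matrix.mulVec_smul, hB, smul_smul]
    congr 1
    rw [pow_succ', mul_assoc, mul_inv_cancel_left₀ hζ_ne, mul_comm]
  refine Module.End.hasEigenvalue_of_hasEigenvector
    (x := ∑ j ∈ Finset.range k, term j) ⟨?_, fun hzero => ?_⟩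
  · rw [Module.End.mem_eigenspace_iff, Matrix.toLin'_apply, Matrix.mulVec_sum, ← shift,
      Finset.smul_sum]
    exact Finset.sum_congr rfl fun j _ => mulVec_term j
  · have term_apply (j : ℕ) (hj : j ∈ Finset.range k) (hj0 : j ≠ 0) : term j x = 0 := by
      have hne : x ≠ σ^[j] x := fun h =>
        (Function.IsPeriodicPt.minimalPeriod_le (Nat.pos_of_ne_zero hj0) h.symm).not_gt
          (Finset.mem_range.1 hj)
      simp [term, Pi.single_eq_of_ne hne]
    have h := congrFun hzero x
    rw [Finset.sum_apply, Finset.sum_eq_single_of_mem 0 (Finset.mem_range.2 hk) term_apply] at h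
    simp [term] at h

variable [Finite ι] (σ : Equiv.Perm ι)

theorem exists_rootOfUnity_eq_imp_of_sameCycle :
    ∃ ζ : ι → ℂ, (∀ x, ζ x ^ Function.minimalPeriod σ x = 1) ∧
      ∀ x y, σ.SameCycle x y → ζ x = ζ y → x = y := by
  let rep (x : ι) : ι := (Quotient.mk (Equiv.Perm.SameCycle.setoid σ) x).out
  have periodic (x : ι) : x ∈ Function.periodicPts σ := σ.injective.mem_periodicPts x
  have position (x : ι) : ∃ p < Function.minimalPeriod σ (rep x), σ^[p] (rep x) = x := by
    obtain ⟨p, hp⟩ := (Quotient.mk_out (s := Equiv.Perm.SameCycle.setoid σ) x).exists_nat_pow_eq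
    refine ⟨p % _, Nat.mod_lt _ (Function.minimalPeriod_pos_of_mem_periodicPts (periodic _)), ?_⟩
    rwa [Function.iterate_mod_minimalPeriod_eq, ← Equiv.Perm.coe_pow]
  choose p hp hpx using position
  have primitive (x : ι) := Complex.isPrimitiveRoot_exp (Function.minimalPeriod σ (rep x))
    (Function.minimalPeriod_pos_of_mem_periodicPts (periodic _)).ne'
  refine ⟨fun x => Complex.exp (2 * Real.pi * Complex.I / Function.minimalPeriod σ (rep x)) ^ p x,
    fun x => ?_, fun x y hxy heq => ?_⟩
  · have period_eq : Function.minimalPeriod σ x = Function.minimalPeriod σ (rep x) := by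
      conv_lhs => rw [← hpx x]
      exact Function.minimalPeriod_apply_iterate (periodic _) _
    rw [period_eq, pow_right_comm, (primitive x).pow_eq_one, one_pow]
  · have rep_eq : rep x = rep y :=
      congrArg Quotient.out (Quotient.sound (s := Equiv.Perm.SameCycle.setoid σ) hxy)
    simp only [rep_eq] at heq
    rw [← hpx x, ← hpx y, rep_eq, (primitive y).pow_inj (rep_eq ▸ hp x) (hp y) heq]

theorem exists_weight_mul_rootOfUnity_injective :
    ∃ (w : ι → ℝ) (ζ : ι → ℂ), (∀ x, w (σ x) = w x) ∧ (∀ x, 0 < w x) ∧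
      (∀ x, ζ x ^ Function.minimalPeriod σ x = 1) ∧
      Function.Injective fun x => (w x : ℂ) * ζ x := by
  -- Absolute values separate distinct cycles, roots of unity the points of one cycle.
  obtain ⟨ζ, hζ, hζ_inj⟩ := exists_rootOfUnity_eq_imp_of_sameCycle σ
  obtain ⟨index, hindex⟩ :=
    Countable.exists_injective_nat (Quotient (Equiv.Perm.SameCycle.setoid σ))
  let w (x : ι) : ℝ := index (Quotient.mk _ x) + 1
  have hw (x : ι) : 0 < w x := by positivity
  have norm_eq (x : ι) : ‖(w x : ℂ) * ζ x‖ = w x := by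
    have hperiod := Function.minimalPeriod_pos_of_mem_periodicPts (σ.injective.mem_periodicPts x)
    rw [norm_mul, Complex.norm_real, Real.norm_of_nonneg (hw x).le,
      Complex.norm_eq_one_of_pow_eq_one (hζ x) hperiod.ne', mul_one]
  refine ⟨w, ζ, fun x => ?_, hw, hζ, fun x y hxy => ?_⟩
  · have hclass := Quotient.sound (s := Equiv.Perm.SameCycle.setoid σ)
      (Equiv.Perm.sameCycle_apply_left.2 (Equiv.Perm.SameCycle.refl σ x))
    simp only [w, hclass]
  · have w_eq : w x = w y :=
      (norm_eq x).symm.trans ((congrArg norm hxy).trans (norm_eq y))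
    have same : σ.SameCycle x y := Quotient.exact (hindex (by simpa [w] using w_eq))
    refine hζ_inj x y same (mul_left_cancel₀ (Complex.ofReal_ne_zero.2 (hw y).ne') ?_)
    simpa only [w_eq] using hxy

end WeightedPermutation

namespace StructuredMatrix

section GenericRealization

variable {n₁ n₂ : ℕ} {K : Type*} [Field K]

open Classical in
/-- The realization of `A` by the indeterminates of the polynomial ring in its free entries, of
which every realization is a specialization. -/
noncomputable def genericRealization (A : StructuredMatrix n₁ n₂) :
    Matrix (Fin n₁) (Fin n₂) (MvPolynomial A.FreeEntry ℝ) :=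
  Matrix.of fun i j => if h : A i j = StructEntry.star then MvPolynomial.X ⟨(i, j), h⟩ else 0

theorem supports_genericRealization (A : StructuredMatrix n₁ n₂) :
    A.Supports A.genericRealization := by
  intro i j
  contrapose!
  simp +contextual [genericRealization]

theorem genericRealization_map_comp_eval (A : StructuredMatrix n₁ n₂) (φ : ℝ →+* K)
    (θ : A.ParamSpace) :
    A.genericRealization.map (φ.comp (MvPolynomial.eval θ)) = (A.realization θ).map φ := by
  ext i j
  by_cases h : A i j = StructEntry.star <;> simp [genericRealization, realization, h]

theorem holdsGenerically_grank_le_rank (A : StructuredMatrix n₁ n₂) (φ : ℝ →+* K) :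
    HoldsGenerically fun θ : A.ParamSpace => A.grank ≤ ((A.realization θ).map φ).rank := by
  obtain ⟨θ₀, hθ₀⟩ := A.isGreatest_grank.1
  obtain ⟨e, f, -, -, hdet⟩ := exists_submatrix_rank_det_ne_zero (A.realization θ₀)
  have map_minor (θ : A.ParamSpace) :
      (((A.realization θ).map φ).submatrix e f).det =
        φ (MvPolynomial.eval θ (A.genericRealization.submatrix e f).det) := by
    rw [← genericRealization_map_comp_eval, Matrix.submatrix_map, ← RingHom.mapMatrix_apply,
      ← RingHom.map_det, RingHom.comp_apply]
  have minor_ne_zero : (((A.realization θ₀).map φ).submatrix e f).det ≠ 0 := by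
    rw [Matrix.submatrix_map, ← RingHom.mapMatrix_apply, ← RingHom.map_det]
    exact (map_ne_zero φ).2 hdet
  refine ⟨(A.genericRealization.submatrix e f).det, fun hzero => minor_ne_zero ?_, fun θ hθ => ?_⟩
  · rw [map_minor, hzero, map_zero, map_zero]
  · have hle := card_le_rank_of_submatrix_det_ne_zero
      (A := (A.realization θ).map φ) (e := e) (f := f) (by rwa [map_minor, map_ne_zero])
    rwa [Fintype.card_fin, show (A.realization θ₀).rank = A.grank from hθ₀] at hle

end GenericRealization

section Diagonalizability

variable {n : ℕ} {A : StructuredMatrix n n}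

theorem exists_realization_mulVec_single {K : Type*} [Field K] (φ : ℝ →+* K)
    {σ : Equiv.Perm (Fin n)} {S : Set (Fin n)} (h : IsPermutationCover A.digraph σ S)
    (w : Fin n → ℝ) :
    ∃ θ, ∀ x ∈ S, ((A.realization θ).map φ).mulVec (Pi.single x 1) =
      φ (w x) • Pi.single (σ x) 1 := by
  classical
  refine ⟨fun p => if p.1.1 = σ p.1.2 then w p.1.2 else 0, fun x hx => ?_⟩
  ext i
  rw [Matrix.mulVec_single_one, Matrix.col_apply, Matrix.map_apply, Pi.smul_apply, Pi.single_apply]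
  have hstar : A (σ x) x = StructEntry.star := (h x hx).2
  by_cases hi : i = σ x
  · subst hi
    simp [realization, hstar]
  · simp [realization, hi]

theorem exists_realization_distinct_eigenvalues (A : StructuredMatrix n n) :
    ∃ (θ : A.ParamSpace) (μ : Fin A.maxCycleCover → ℂ), Function.Injective μ ∧ (∀ k, μ k ≠ 0) ∧
      ∀ k, Module.End.HasEigenvalue
        (Matrix.toLin' ((A.realization θ).map Complex.ofRealHom)) (μ k) := by
  obtain ⟨σ, S, hσ, hcard⟩ := A.exists_isPermutationCover_ncard_eq_maxCycleCover
  obtain ⟨w, ζ, hw, hw_pos, hζ, hinj⟩ := exists_weight_mul_rootOfUnity_injective σ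
  obtain ⟨θ, hθ⟩ := exists_realization_mulVec_single Complex.ofRealHom hσ w
  let x : Fin A.maxCycleCover ≃ S := (Finite.equivFinOfCardEq hcard).symm
  have period_ne (y : Fin n) : Function.minimalPeriod σ y ≠ 0 :=
    (Function.minimalPeriod_pos_of_mem_periodicPts (σ.injective.mem_periodicPts y)).ne'
  have w_iterate (y : Fin n) (j : ℕ) : w (σ^[j] y) = w y := by
    induction j with
    | zero => rfl
    | succ j ih => rw [Function.iterate_succ_apply', hw, ih]
  refine ⟨θ, fun k => w (x k) * ζ (x k), hinj.comp (Subtype.val_injective.comp x.injective),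
    fun k => ?_, fun k => ?_⟩
  · refine mul_ne_zero (Complex.ofReal_ne_zero.2 (hw_pos _).ne') fun hzero => ?_
    have := hζ (x k)
    rw [hzero, zero_pow (period_ne _)] at this
    exact zero_ne_one this
  · refine hasEigenvalue_of_mulVec_single_iterate (σ := σ) (x := x k) (fun j => ?_) (hζ _)
    rw [hθ _ (hσ.iterate_mem (x k).2 j), w_iterate, Function.iterate_succ_apply']
    rfl

open Polynomial in
theorem genericallyDiagonalizable_of_grank_eq_maxCycleCover (h : A.grank = A.maxCycleCover) :
    A.GenericallyDiagonalizable := by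
  refine holdsGenerically_iff_exists_isProperRealVariety.1 ?_
  let φ (θ : A.ParamSpace) := Complex.ofRealHom.comp (MvPolynomial.eval θ)
  obtain ⟨q, hq⟩ := A.supports_genericRealization.X_pow_dvd_charpoly
  have charpoly_eq (θ : A.ParamSpace) : ((A.realization θ).map Complex.ofRealHom).charpoly =
      X ^ (n - A.maxCycleCover) * q.map (φ θ) := by
    rw [← genericRealization_map_comp_eval, Matrix.charpoly_map, hq, Polynomial.map_mul,
      Polynomial.map_pow, map_X]
  have rank_le (θ : A.ParamSpace) :
      ((A.realization θ).map Complex.ofRealHom).rank ≤ A.maxCycleCover :=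
    h ▸ ((supports_realization θ).map Complex.ofRealHom).rank_le_grank
  have hmonic : (X * q).Monic :=
    monic_X.mul ((monic_X_pow _).of_mul_monic_left (hq ▸ A.genericRealization.charpoly_monic))
  let discriminant := resultant (X * q) (derivative (X * q)) (X * q).natDegree (X * q).natDegree
  have separable_iff (θ : A.ParamSpace) :
      MvPolynomial.eval θ discriminant ≠ 0 ↔ (X * q.map (φ θ)).Separable := by
    have := map_resultant_derivative_ne_zero_iff (φ θ) hmonic
    simpa [φ] using this
  refine ⟨discriminant, fun hzero => ?_, fun θ hθ => ?_⟩
  · obtain ⟨θ, μ, hinj, hne, hμ⟩ := A.exists_realization_distinct_eigenvalues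
    refine (separable_iff θ).2 (separable_X_mul_of_charpoly_eq (charpoly_eq θ) hμ hinj hne ?_) ?_
    · rw [Fintype.card_fin, Fintype.card_fin, Nat.sub_add_cancel A.maxCycleCover_le]
    · rw [hzero, map_zero]
  · refine isDiagonalizable_of_charpoly_eq_X_pow_mul (charpoly_eq θ) ((separable_iff θ).1 hθ) ?_
    rw [Fintype.card_fin]
    exact (Nat.add_le_add_right (rank_le θ) _).trans (Nat.add_sub_of_le A.maxCycleCover_le).le

theorem grank_eq_maxCycleCover_of_genericallyDiagonalizable (h : A.GenericallyDiagonalizable) :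
    A.grank = A.maxCycleCover := by
  refine le_antisymm ?_ A.maxCycleCover_le_grank
  have hdiag : HoldsGenerically fun θ : A.ParamSpace =>
      IsDiagonalizable ((A.realization θ).map Complex.ofRealHom) :=
    holdsGenerically_iff_exists_isProperRealVariety.2 h
  obtain ⟨θ, hθ, hrank⟩ := (hdiag.and (A.holdsGenerically_grank_le_rank Complex.ofRealHom)).exists
  have hB := (supports_realization θ).map Complex.ofRealHom
  have hmult : n - A.maxCycleCover ≤
      ((A.realization θ).map Complex.ofRealHom).charpoly.rootMultiplicity 0 := by
    rw [Polynomial.le_rootMultiplicity_iff (Matrix.charpoly_monic _).ne_zero, Polynomial.C_0,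
      sub_zero]
    exact hB.X_pow_dvd_charpoly
  have hcard := hθ.rank_add_rootMultiplicity_charpoly
  rw [Fintype.card_fin] at hcard
  omega

end Diagonalizability

end StructuredMatrix

theorem mainTheorem1 (n : ℕ) (A : StructuredMatrix n n) :
    List.TFAE [
      A.GenericallyDiagonalizable,
      A.grank = A.maxCycleCover,
      ∃ M : Finset (Fin n × Fin n), A.bipartite.IsMaximumMatching M ∧
        (edgeSetDigraph M).IsUnionOfDisjointCyclesAndIsolated] := by
  tfae_have 1 → 2 := StructuredMatrix.grank_eq_maxCycleCover_of_genericallyDiagonalizable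
  tfae_have 2 → 1 := StructuredMatrix.genericallyDiagonalizable_of_grank_eq_maxCycleCover
  tfae_have 2 → 3 :=
    StructuredMatrix.exists_isMaximumMatching_isUnionOfDisjointCyclesAndIsolated
  tfae_have 3 → 2 := fun ⟨M, hM, hunion⟩ =>
    le_antisymm (StructuredMatrix.card_eq_grank_of_isMaximumMatching hM ▸
      StructuredMatrix.card_le_maxCycleCover_of_isUnionOfDisjointCyclesAndIsolated hM.1 hunion)
      A.maxCycleCover_le_grank
  tfae_finish
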